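/- Let $H^2$ be the Hardy space of functions $f(z)=\sum_{n\ge 0}a_nz^n$ on the open unit disk $\mathbb D$ with $\|f\|_{H^2}^2=\sum_{n\ge0}|a_n|^2<\infty$. For $f\in H^2$ and $\zeta\in\overline{\mathbb D}$ define the local Dirichlet integral $$D_\zeta(f)=\left\|\frac{f-f(\zeta)}{z-\zeta}\right\|_{H^2}^2\in[0,\infty],$$ where the norm is $\infty$ if the quotient is not in $H^2$; when $|\zeta|=1$, $f(\zeta)$ denotes the nontangential limit of $f$ at $\zeta$, and $D_\zeta(f)=\infty$ if this limit does not exist. For a finite positive Borel measure $\mu$ on $\overline{\mathbb D}$, the Dirichlet-type space $D(\mu)$ is the Hilbert space of all $f\in H^2$ with $\int_{\overline{\mathbb D}} D_\zeta(f)\,d\mu(\zeta)<\infty$, with norm $$\|f\|^2=\|f\|_{H^2}^2+\int_{\overline{\mathbb D}} D_\zeta(f)\,d\mu(\zeta),$$ on which the operator $M_z$ of multiplication by $z$ is bounded. Let $\mu$ be a finite positive Borel measure on $\overline{\mathbb D}$, let $\Delta_{M_z}=M_z^*M_z-I$ be the defect operator of $M_z$ on $D(\mu)$, and let $k\ge 0$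 be an integer. Then the following are equivalent: (i) $\Delta_{M_z}$ has rank $k$ (its range has dimension $k$); (ii) there exist constants $c_1,\dots,c_k>0$ and distinct points $\zeta_1,\dots,\zeta_k\in\overline{\mathbb D}$ such that $\mu=\sum_{i=1}^k c_i\delta_{\zeta_i}$. (For $k=0$, (ii) means $\mu=0$.) -/

import Mathlib

noncomputable section

namespace DirichletType

open Filter Topology MeasureTheory
open scoped NNReal ENNReal

/-- The closed unit disk of `ℂ`, as a measurable and topological space. -/
abbrev ClosedDisk : Type := ↥(Metric.closedBall (0 : ℂ) 1)

/-! ### The Hardy space -/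

/-- The Hardy space `H²` of the unit disk: a function `f(z) = ∑ aₙ zⁿ` with square summable Taylor
coefficients is represented by its coefficient sequence, and `‖f‖² = ∑ |aₙ|²`.
The function itself is `hardyEval f`. -/
abbrev HardySpace : Type := lp (fun _ : ℕ => ℂ) 2

/-- The value `f(z) = ∑ aₙ zⁿ` of `f ∈ H²` (used for `‖z‖ < 1`, where the series converges). -/
def hardyEval (f : HardySpace) (z : ℂ) : ℂ := ∑' n, f n * z ^ n

/-- `F` has the nontangential limit `w` at the boundary point `ζ`: it tends to `w` within every
Stolz region `{z : |z| < 1, |z - ζ| ≤ M (1 - |z|)}`. -/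
def HasNontangentialLimit (F : ℂ → ℂ) (ζ w : ℂ) : Prop :=
  ∀ M : ℝ, Tendsto F (𝓝[{z : ℂ | ‖z‖ < 1 ∧ ‖z - ζ‖ ≤ M * (1 - ‖z‖)}] ζ) (𝓝 w)

/-- `‖(f - w) / (z - ζ)‖²` in `H²`: the squared norm of the `h ∈ H²` which is the quotient
`(f - w) / (z - ζ)` on the unit disk, and `∞` if the quotient is not in `H²`.
There is at most one such `h`, so the infimum only serves to select it. -/
def quotientNormSq (f : HardySpace) (ζ w : ℂ) : ℝ≥0∞ :=
  ⨅ (h : HardySpace)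
    (_ : ∀ z : ℂ, ‖z‖ < 1 → (z - ζ) * hardyEval h z = hardyEval f z - w), ‖h‖ₑ ^ 2

open Classical in
/-- The local Dirichlet integral `D_ζ(f)` at a point `ζ` of the closed unit disk. For `|ζ| = 1` it
is `∞` if `f` has no nontangential limit at `ζ`; a nontangential limit is unique, so
the infimum only serves to select it. -/
def localDirichlet (ζ : ℂ) (f : HardySpace) : ℝ≥0∞ :=
  if ‖ζ‖ < 1 then quotientNormSq f ζ (hardyEval f ζ)
  else ⨅ (w : ℂ) (_ : HasNontangentialLimit (hardyEval f) ζ w), quotientNormSq f ζ w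

/-- `∫ D_ζ(f) dμ(ζ)`. -/
def dirichletEnergy (μ : Measure ClosedDisk) (f : HardySpace) : ℝ≥0∞ :=
  ∫⁻ ζ : ClosedDisk, localDirichlet (ζ : ℂ) f ∂μ

/-! ### Facts about the Hardy space -/

theorem enorm_sq_eq (f : HardySpace) : ‖f‖ₑ ^ 2 = ∑' n, ‖f n‖ₑ ^ 2 := by
  have h := lp.hasSum_norm (p := 2) (by norm_num) f
  simp only [ENNReal.toReal_ofNat, Real.rpow_two] at h
  have h2 := ENNReal.ofReal_tsum_of_nonneg (fun n => sq_nonneg ‖f n‖) h.summable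
  rw [h.tsum_eq] at h2
  simpa [ENNReal.ofReal_pow, ofReal_norm] using h2

theorem exists_of_tsum_lt_top (b : ℕ → ℂ) (hb : ∑' n, ‖b n‖ₑ ^ 2 ≠ ∞) :
    ∃ h : HardySpace, ∀ n, h n = b n := by
  have hs : Summable fun n => ‖b n‖ ^ 2 := by
    have := ENNReal.summable_toReal hb
    simpa using this
  exact ⟨⟨b, memℓp_gen (by simpa using hs)⟩, fun n => rfl⟩

theorem norm_coeff_le (f : HardySpace) (n : ℕ) : ‖f n‖ ≤ ‖f‖ :=
  lp.norm_apply_le_norm (by norm_num) f n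

theorem summable_eval (f : HardySpace) {z : ℂ} (hz : ‖z‖ < 1) :
    Summable fun n => f n * z ^ n := by
  refine Summable.of_norm_bounded
    ((summable_geometric_of_lt_one (norm_nonneg z) hz).mul_left ‖f‖) fun n => ?_
  rw [norm_mul, norm_pow]
  gcongr
  exact norm_coeff_le f n

/-- Multiplication by `z` on `H²`. -/
def hardyShift (f : HardySpace) : HardySpace :=
  ⟨fun n => Nat.casesOn n 0 fun m => f m, by
    refine memℓp_gen ?_
    rw [← summable_nat_add_iff 1]
    exact (lp.memℓp f).summable (by norm_num)⟩

@[simp] theorem hardyShift_zero (f : HardySpace) : hardyShift f 0 = 0 := rfl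

@[simp] theorem hardyShift_succ (f : HardySpace) (n : ℕ) : hardyShift f (n + 1) = f n := rfl

theorem enorm_hardyShift (f : HardySpace) : ‖hardyShift f‖ₑ = ‖f‖ₑ := by
  have : ‖hardyShift f‖ₑ ^ 2 = ‖f‖ₑ ^ 2 := by
    rw [enorm_sq_eq, enorm_sq_eq, tsum_eq_zero_add' ENNReal.summable]
    simp
  exact (ENNReal.pow_right_strictMono (n := 2) (by norm_num)).injective this

theorem hardyEval_hardyShift (f : HardySpace) {z : ℂ} (hz : ‖z‖ < 1) :
    hardyEval (hardyShift f) z = z * hardyEval f z := by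
  rw [hardyEval, (summable_eval (hardyShift f) hz).tsum_eq_zero_add, hardyEval, ← tsum_mul_left]
  simp only [hardyShift_zero, hardyShift_succ, zero_mul, zero_add]
  congr 1; ext n; ring

theorem hardyEval_injective (f g : HardySpace)
    (h : ∀ z : ℂ, ‖z‖ < 1 → hardyEval f z = hardyEval g z) : f = g := by
  have key : ∀ f : HardySpace, HasFPowerSeriesAt (hardyEval f)
      (FormalMultilinearSeries.ofScalars ℂ (fun n => f n)) 0 := by
    intro f
    rw [hasFPowerSeriesAt_iff]
    filter_upwards [Metric.ball_mem_nhds (0 : ℂ) one_pos] with z hz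
    have hz' : ‖z‖ < 1 := by simpa using hz
    have := (summable_eval f hz').hasSum
    simpa [hardyEval, smul_eq_mul, mul_comm, FormalMultilinearSeries.coeff_ofScalars] using this
  have hev : hardyEval f =ᶠ[𝓝 0] hardyEval g := by
    filter_upwards [Metric.ball_mem_nhds (0 : ℂ) one_pos] with z hz
    exact h z (by simpa using hz)
  have e := (key f).eq_formalMultilinearSeries_of_eventually (key g) hev
  ext n
  have := congrArg (fun p => FormalMultilinearSeries.coeff p n) e
  simpa [FormalMultilinearSeries.coeff_ofScalars] using this

theorem hardyEval_growth (f : HardySpace) {z : ℂ} (hz : ‖z‖ < 1) :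
    ‖hardyEval f z‖ ^ 2 * (1 - ‖z‖) ≤ ‖f‖ ^ 2 := by
  have hf := lp.hasSum_norm (p := 2) (by norm_num) f
  simp only [ENNReal.toReal_ofNat, Real.rpow_two] at hf
  have hz2 : ‖z‖ ^ 2 < 1 := by nlinarith [norm_nonneg z]
  have hg := hasSum_geometric_of_lt_one (sq_nonneg ‖z‖) hz2
  have hfin : ∀ N : ℕ, ‖∑ n ∈ Finset.range N, f n * z ^ n‖ ^ 2 ≤ ‖f‖ ^ 2 * (1 - ‖z‖ ^ 2)⁻¹ := by
    intro N
    calc ‖∑ n ∈ Finset.range N, f n * z ^ n‖ ^ 2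
        ≤ (∑ n ∈ Finset.range N, ‖f n‖ * ‖z‖ ^ n) ^ 2 := by
          gcongr
          refine (norm_sum_le _ _).trans (le_of_eq ?_)
          simp
      _ ≤ (∑ n ∈ Finset.range N, ‖f n‖ ^ 2) * ∑ n ∈ Finset.range N, (‖z‖ ^ n) ^ 2 :=
          Finset.sum_mul_sq_le_sq_mul_sq _ _ _
      _ ≤ ‖f‖ ^ 2 * (1 - ‖z‖ ^ 2)⁻¹ := by
          gcongr
          · exact sum_le_hasSum _ (fun n _ => sq_nonneg _) hf
          · have : ∀ n, (‖z‖ ^ n) ^ 2 = (‖z‖ ^ 2) ^ n := fun n => by ring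
            simp only [this]
            exact sum_le_hasSum _ (fun n _ => by positivity) hg
  have hlim := (summable_eval f hz).hasSum.tendsto_sum_nat
  have h1 : ‖hardyEval f z‖ ^ 2 ≤ ‖f‖ ^ 2 * (1 - ‖z‖ ^ 2)⁻¹ :=
    le_of_tendsto ((hlim.norm).pow 2) (Eventually.of_forall hfin)
  have hpos : 0 < 1 - ‖z‖ ^ 2 := by linarith
  have h2 : ‖hardyEval f z‖ ^ 2 * (1 - ‖z‖ ^ 2) ≤ ‖f‖ ^ 2 := by
    rwa [← div_eq_mul_inv, le_div_iff₀ hpos] at h1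
  refine le_trans ?_ h2
  gcongr
  nlinarith [norm_nonneg z]

/-! ### Difference quotients through Taylor coefficients -/

/-- The Taylor coefficients `a`, `b` satisfy `∑ aₙ zⁿ = w + (z - ζ) ∑ bₙ zⁿ` for some `w`. -/
def QuotRel (ζ : ℂ) (a b : ℕ → ℂ) : Prop := ∀ n, a (n + 1) = b n - ζ * b (n + 1)

theorem QuotRel.add {ζ : ℂ} {a b a' b' : ℕ → ℂ} (h : QuotRel ζ a b) (h' : QuotRel ζ a' b') :
    QuotRel ζ (a + a') (b + b') := fun n => by
  have h1 := h n
  have h2 := h' n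
  simp only [Pi.add_apply]
  rw [h1, h2]; ring

theorem QuotRel.smul {ζ : ℂ} {a b : ℕ → ℂ} (c : ℂ) (h : QuotRel ζ a b) :
    QuotRel ζ (c • a) (c • b) := fun n => by
  have h1 := h n
  simp only [Pi.smul_apply, smul_eq_mul]
  rw [h1]; ring

theorem QuotRel.eval {ζ : ℂ} {f h : HardySpace} (r : QuotRel ζ f h) {z : ℂ} (hz : ‖z‖ < 1) :
    (z - ζ) * hardyEval h z = hardyEval f z - (f 0 + ζ * h 0) := by
  have h1 := summable_eval h hz
  have h2 : Summable fun n => h (n + 1) * z ^ (n + 1) :=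
    (summable_nat_add_iff (f := fun n => h n * z ^ n) 1).2 h1
  have e1 : hardyEval f z = f 0 + ∑' n, f (n + 1) * z ^ (n + 1) := by
    rw [hardyEval, (summable_eval f hz).tsum_eq_zero_add]; simp
  have e2 : hardyEval h z = h 0 + ∑' n, h (n + 1) * z ^ (n + 1) := by
    rw [hardyEval, h1.tsum_eq_zero_add]; simp
  have e3 : ∑' n, f (n + 1) * z ^ (n + 1)
      = z * hardyEval h z - ζ * ∑' n, h (n + 1) * z ^ (n + 1) := by
    rw [hardyEval, ← tsum_mul_left, ← tsum_mul_left, ← (h1.mul_left z).tsum_sub (h2.mul_left ζ)]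
    congr 1; ext n; rw [r n]; ring
  rw [e1, e3]
  linear_combination (-ζ) * e2

theorem QuotRel.of_eval {ζ w : ℂ} {f h : HardySpace}
    (H : ∀ z : ℂ, ‖z‖ < 1 → (z - ζ) * hardyEval h z = hardyEval f z - w) : QuotRel ζ f h := by
  let e : HardySpace := lp.single 2 0 w
  have he : ∀ z : ℂ, hardyEval e z = w := by
    intro z
    rw [hardyEval, tsum_eq_single 0]
    · simp [e]
    · intro n hn; simp [e, hn]
  have key : hardyShift h = ζ • h + f - e := by
    refine hardyEval_injective _ _ fun z hz => ?_
    rw [hardyEval_hardyShift h hz]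
    have : hardyEval (ζ • h + f - e) z = ζ * hardyEval h z + hardyEval f z - hardyEval e z := by
      simp only [hardyEval]
      rw [← tsum_mul_left, ← ((summable_eval h hz).mul_left ζ).tsum_add (summable_eval f hz),
        ← (((summable_eval h hz).mul_left ζ).add (summable_eval f hz)).tsum_sub
          (summable_eval e hz)]
      congr 1; ext n
      simp only [lp.coeFn_sub, lp.coeFn_add, lp.coeFn_smul, Pi.sub_apply, Pi.add_apply,
        Pi.smul_apply, smul_eq_mul]
      ring
    rw [this, he]
    linear_combination H z hz
  intro n
  have := congrArg (fun g : HardySpace => g (n + 1)) key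
  have e1 : e (n + 1) = 0 := by simp [e]
  simp only [hardyShift_succ, lp.coeFn_sub, lp.coeFn_add, lp.coeFn_smul, Pi.sub_apply,
    Pi.add_apply, Pi.smul_apply, smul_eq_mul, e1] at this
  linear_combination -this

theorem QuotRel.hasNontangentialLimit {ζ : ℂ} {f h : HardySpace} (r : QuotRel ζ f h)
    (hζ : ‖ζ‖ = 1) : HasNontangentialLimit (hardyEval f) ζ (f 0 + ζ * h 0) := by
  intro M
  rw [tendsto_iff_norm_sub_tendsto_zero]
  have hlim : Tendsto (fun z : ℂ => |M| * ‖h‖ * √(1 - ‖z‖))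
      (𝓝[{z : ℂ | ‖z‖ < 1 ∧ ‖z - ζ‖ ≤ M * (1 - ‖z‖)}] ζ) (𝓝 0) := by
    have hc : Continuous fun z : ℂ => |M| * ‖h‖ * √(1 - ‖z‖) := by fun_prop
    have := (hc.tendsto ζ).mono_left
      (nhdsWithin_le_nhds (s := {z : ℂ | ‖z‖ < 1 ∧ ‖z - ζ‖ ≤ M * (1 - ‖z‖)}))
    simpa [hζ] using this
  refine squeeze_zero' (Eventually.of_forall fun z => norm_nonneg _) ?_ hlim
  filter_upwards [self_mem_nhdsWithin] with z hz
  obtain ⟨hz1, hz2⟩ := hz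
  rw [← r.eval hz1, norm_mul]
  have hp : 0 < 1 - ‖z‖ := by linarith
  have hs : √(1 - ‖z‖) * √(1 - ‖z‖) = 1 - ‖z‖ := Real.mul_self_sqrt hp.le
  have h1 : ‖hardyEval h z‖ * √(1 - ‖z‖) ≤ ‖h‖ := by
    refine abs_le_of_sq_le_sq' ?_ (norm_nonneg _) |>.2
    rw [mul_pow, Real.sq_sqrt hp.le]
    exact hardyEval_growth h hz1
  calc ‖z - ζ‖ * ‖hardyEval h z‖ ≤ (|M| * (1 - ‖z‖)) * ‖hardyEval h z‖ := by
        gcongr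
        exact hz2.trans (mul_le_mul_of_nonneg_right (le_abs_self M) hp.le)
    _ = |M| * (‖hardyEval h z‖ * √(1 - ‖z‖)) * √(1 - ‖z‖) := by
        linear_combination (-(|M| * ‖hardyEval h z‖)) * hs
    _ ≤ |M| * ‖h‖ * √(1 - ‖z‖) := by gcongr

theorem localDirichlet_le {ζ : ℂ} (hζ : ‖ζ‖ ≤ 1) {f h : HardySpace} (r : QuotRel ζ f h) :
    localDirichlet ζ f ≤ ‖h‖ₑ ^ 2 := by
  unfold localDirichlet quotientNormSq
  split_ifs with h1
  · refine iInf₂_le h fun z hz => ?_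
    have e := r.eval h1
    rw [sub_self, zero_mul] at e
    rw [r.eval hz]
    linear_combination -e
  · exact (iInf₂_le (f 0 + ζ * h 0)
      (r.hasNontangentialLimit (le_antisymm hζ (not_lt.1 h1)))).trans
        (iInf₂_le h fun z hz => r.eval hz)

theorem le_localDirichlet {ζ : ℂ} {f : HardySpace} {c : ℝ≥0∞}
    (H : ∀ h : HardySpace, QuotRel ζ f h → c ≤ ‖h‖ₑ ^ 2) : c ≤ localDirichlet ζ f := by
  unfold localDirichlet quotientNormSq
  split_ifs with h1
  · exact le_iInf₂ fun h hh => H h (QuotRel.of_eval hh)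
  · exact le_iInf₂ fun w _ => le_iInf₂ fun h hh => H h (QuotRel.of_eval hh)

theorem QuotRel.unique {ζ : ℂ} (hζ : ‖ζ‖ ≤ 1) {f h h' : HardySpace} (r : QuotRel ζ f h)
    (r' : QuotRel ζ f h') : h = h' := by
  have hd : ∀ n, ‖(h - h') n‖ ≤ ‖(h - h') (n + 1)‖ := by
    intro n
    have : (h - h') n = ζ * (h - h') (n + 1) := by
      have h1 := r n
      have h2 := r' n
      simp only [lp.coeFn_sub, Pi.sub_apply]
      linear_combination h2 - h1
    rw [this, norm_mul]
    exact mul_le_of_le_one_left (norm_nonneg _) hζ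
  have hm : Monotone fun n => ‖(h - h') n‖ := monotone_nat_of_le_succ hd
  have ht : Tendsto (fun n => ‖(h - h') n‖ ^ 2) atTop (𝓝 0) := by
    have := (lp.hasSum_norm (p := 2) (by norm_num) (h - h')).summable.tendsto_atTop_zero
    simpa using this
  have ht' : Tendsto (fun n => ‖(h - h') n‖) atTop (𝓝 0) := by
    have := ht.sqrt
    simpa using this
  refine sub_eq_zero.1 ?_
  ext n
  have : ‖(h - h') n‖ ≤ 0 := hm.ge_of_tendsto ht' n
  simpa using this

theorem localDirichlet_eq {ζ : ℂ} (hζ : ‖ζ‖ ≤ 1) {f h : HardySpace} (r : QuotRel ζ f h) :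
    localDirichlet ζ f = ‖h‖ₑ ^ 2 :=
  le_antisymm (localDirichlet_le hζ r) (le_localDirichlet fun h' r' => by rw [r.unique hζ r'])

theorem exists_quotRel {ζ : ℂ} {f : HardySpace} (H : localDirichlet ζ f ≠ ∞) :
    ∃ h : HardySpace, QuotRel ζ f h := by
  by_contra hc
  push Not at hc
  exact H (top_le_iff.1 (le_localDirichlet fun h r => (hc h r).elim))

/-! ### Properties of the local Dirichlet integral -/

theorem localDirichlet_smul_le {ζ : ℂ} (hζ : ‖ζ‖ ≤ 1) (c : ℂ) (f : HardySpace) :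
    localDirichlet ζ (c • f) ≤ ‖c‖ₑ ^ 2 * localDirichlet ζ f := by
  by_cases H : localDirichlet ζ f = ∞
  · by_cases hc : c = 0
    · subst hc
      have r : QuotRel ζ ((0 : ℂ) • f : HardySpace) (0 : HardySpace) := fun n => by simp
      rw [localDirichlet_eq hζ r]; simp
    · rw [H, ENNReal.mul_top (by simpa using hc)]; exact le_top
  · obtain ⟨h, r⟩ := exists_quotRel H
    have r' : QuotRel ζ (c • f : HardySpace) (c • h : HardySpace) := r.smul c
    rw [localDirichlet_eq hζ r, localDirichlet_eq hζ r', enorm_smul, mul_pow]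

theorem localDirichlet_add_le {ζ : ℂ} (hζ : ‖ζ‖ ≤ 1) (f g : HardySpace) :
    localDirichlet ζ (f + g) ^ (1 / 2 : ℝ)
      ≤ localDirichlet ζ f ^ (1 / 2 : ℝ) + localDirichlet ζ g ^ (1 / 2 : ℝ) := by
  by_cases H : localDirichlet ζ f = ∞
  · simp [H]
  by_cases H' : localDirichlet ζ g = ∞
  · simp [H']
  obtain ⟨h, r⟩ := exists_quotRel H
  obtain ⟨h', r'⟩ := exists_quotRel H'
  have r2 : QuotRel ζ (f + g : HardySpace) (h + h' : HardySpace) := r.add r'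
  have e : ∀ x : ℝ≥0∞, (x ^ 2) ^ (1 / 2 : ℝ) = x := fun x => by
    rw [← ENNReal.rpow_two, ← ENNReal.rpow_mul]; norm_num
  rw [localDirichlet_eq hζ r, localDirichlet_eq hζ r', localDirichlet_eq hζ r2, e, e, e]
  exact enorm_add_le _ _

theorem enorm_parallelogram (f g : HardySpace) :
    ‖f + g‖ₑ ^ 2 + ‖f - g‖ₑ ^ 2 = 2 * (‖f‖ₑ ^ 2 + ‖g‖ₑ ^ 2) := by
  have h := parallelogram_law_with_norm ℂ f g
  simp only [← ofReal_norm]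
  rw [← ENNReal.ofReal_pow (norm_nonneg _), ← ENNReal.ofReal_pow (norm_nonneg _),
    ← ENNReal.ofReal_pow (norm_nonneg _), ← ENNReal.ofReal_pow (norm_nonneg _),
    ← ENNReal.ofReal_add (by positivity) (by positivity),
    ← ENNReal.ofReal_add (by positivity) (by positivity)]
  have h2 := congrArg ENNReal.ofReal h
  rwa [ENNReal.ofReal_mul (by norm_num), ENNReal.ofReal_ofNat] at h2

theorem localDirichlet_parallelogram_le {ζ : ℂ} (hζ : ‖ζ‖ ≤ 1) (f g : HardySpace) :
    localDirichlet ζ (f + g) + localDirichlet ζ (f - g)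
      ≤ 2 * (localDirichlet ζ f + localDirichlet ζ g) := by
  by_cases H : localDirichlet ζ f = ∞
  · simp [H]
  by_cases H' : localDirichlet ζ g = ∞
  · simp [H']
  obtain ⟨h, r⟩ := exists_quotRel H
  obtain ⟨h', r'⟩ := exists_quotRel H'
  have r2 : QuotRel ζ (f + g : HardySpace) (h + h' : HardySpace) := r.add r'
  have r3 : QuotRel ζ (f - g : HardySpace) (h - h' : HardySpace) := by
    have : QuotRel ζ (f + (-1 : ℂ) • g : HardySpace) (h + (-1 : ℂ) • h' : HardySpace) :=
      r.add (r'.smul (-1))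
    simpa [sub_eq_add_neg] using this
  rw [localDirichlet_eq hζ r, localDirichlet_eq hζ r', localDirichlet_eq hζ r2,
    localDirichlet_eq hζ r3, enorm_parallelogram]

theorem localDirichlet_hardyShift_le {ζ : ℂ} (hζ : ‖ζ‖ ≤ 1) (f : HardySpace) :
    localDirichlet ζ (hardyShift f) ≤ 2 * ‖f‖ₑ ^ 2 + 3 * localDirichlet ζ f := by
  by_cases H : localDirichlet ζ f = ∞
  · simp [H]
  obtain ⟨h, r⟩ := exists_quotRel H
  let L : ℂ := f 0 + ζ * h 0
  have r' : QuotRel ζ (hardyShift f) (hardyShift h + lp.single 2 0 L : HardySpace) := by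
    intro n
    cases n with
    | zero => simp [L]
    | succ n => simpa using r n
  rw [localDirichlet_eq hζ r, localDirichlet_eq hζ r', enorm_sq_eq (hardyShift h + _),
    tsum_eq_zero_add' ENNReal.summable]
  have e : ∑' n, ‖(hardyShift h + lp.single 2 0 L : HardySpace) (n + 1)‖ₑ ^ 2 = ‖h‖ₑ ^ 2 := by
    rw [enorm_sq_eq]; simp
  rw [e]
  have hL : ‖L‖ ^ 2 ≤ 2 * ‖f‖ ^ 2 + 2 * ‖h‖ ^ 2 := by
    have h1 : ‖L‖ ≤ ‖f‖ + ‖h‖ := by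
      refine (norm_add_le _ _).trans (add_le_add (norm_coeff_le f 0) ?_)
      rw [norm_mul]
      exact (mul_le_of_le_one_left (norm_nonneg _) hζ).trans (norm_coeff_le h 0)
    nlinarith [norm_nonneg L, sq_nonneg (‖f‖ - ‖h‖), norm_nonneg f, norm_nonneg h]
  have hL' : ‖L‖ₑ ^ 2 ≤ 2 * ‖f‖ₑ ^ 2 + 2 * ‖h‖ₑ ^ 2 := by
    have := ENNReal.ofReal_le_ofReal hL
    rw [ENNReal.ofReal_add (by positivity) (by positivity), ENNReal.ofReal_mul (by norm_num),
      ENNReal.ofReal_mul (by norm_num)] at this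
    simpa [ENNReal.ofReal_pow, ofReal_norm] using this
  have e0 : (hardyShift h + lp.single 2 0 L : HardySpace) 0 = L := by simp
  rw [e0]
  calc ‖L‖ₑ ^ 2 + ‖h‖ₑ ^ 2 ≤ (2 * ‖f‖ₑ ^ 2 + 2 * ‖h‖ₑ ^ 2) + ‖h‖ₑ ^ 2 := by gcongr
    _ = 2 * ‖f‖ₑ ^ 2 + 3 * ‖h‖ₑ ^ 2 := by ring

theorem continuous_coeff (n : ℕ) : Continuous fun f : HardySpace => f n :=
  (lp.evalCLM (𝕜 := ℂ) (fun _ : ℕ => ℂ) (p := 2) n).continuous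

theorem lowerSemicontinuous_localDirichlet :
    LowerSemicontinuous fun p : ClosedDisk × HardySpace => localDirichlet (p.1 : ℂ) p.2 := by
  rw [lowerSemicontinuous_iff_isClosed_preimage]
  intro y
  by_cases hy : y = ∞
  · subst hy; simp
  let K : Set (ℕ → ℂ) := {b | ∑' n, ‖b n‖ₑ ^ 2 ≤ y}
  have hKc : IsClosed K := by
    have : K = ⋂ s : Finset ℕ, {b | ∑ n ∈ s, ‖b n‖ₑ ^ 2 ≤ y} := by
      ext b
      simp only [K, Set.mem_ofPred_eq, Set.mem_iInter, ENNReal.tsum_eq_iSup_sum, iSup_le_iff]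
    rw [this]
    refine isClosed_iInter fun s => isClosed_le ?_ continuous_const
    refine continuous_finsetSum _ fun n _ => ?_
    exact (ENNReal.continuous_pow 2).comp (continuous_enorm.comp (continuous_apply n))
  have hK : IsCompact K := by
    refine IsCompact.of_isClosed_subset
      (isCompact_univ_pi fun _ : ℕ => isCompact_closedBall (0 : ℂ) √y.toReal) hKc ?_
    intro b hb n _
    have h1 : ‖b n‖ₑ ^ 2 ≤ y := (ENNReal.le_tsum n).trans hb
    have h2 := ENNReal.toReal_mono hy h1
    rw [mem_closedBall_zero_iff]
    refine Real.le_sqrt_of_sq_le ?_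
    simpa using h2
  have hset : (fun p : ClosedDisk × HardySpace => localDirichlet (p.1 : ℂ) p.2) ⁻¹' Set.Iic y
      = Prod.fst '' {q : (ClosedDisk × HardySpace) × K | QuotRel (q.1.1 : ℂ) q.1.2 q.2.1} := by
    ext p
    have hp : ‖(p.1 : ℂ)‖ ≤ 1 := mem_closedBall_zero_iff.1 p.1.2
    simp only [Set.mem_preimage, Set.mem_Iic, Set.mem_image, Set.mem_ofPred_eq]
    constructor
    · intro h
      obtain ⟨b, r⟩ := exists_quotRel (ne_top_of_le_ne_top hy h)
      rw [localDirichlet_eq hp r, enorm_sq_eq] at h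
      exact ⟨(p, ⟨b, h⟩), r, rfl⟩
    · rintro ⟨⟨p', ⟨b, hb⟩⟩, r, rfl⟩
      obtain ⟨g, hg⟩ := exists_of_tsum_lt_top b (ne_top_of_le_ne_top hy hb)
      have hg' : (g : ℕ → ℂ) = b := funext hg
      have r' : QuotRel (p'.1 : ℂ) p'.2 g := by rw [hg']; exact r
      simp only
      rw [localDirichlet_eq hp r', enorm_sq_eq, hg']
      exact hb
  rw [hset]
  have : CompactSpace K := isCompact_iff_compactSpace.1 hK
  refine isClosedMap_fst_of_compactSpace _ ?_
  simp only [QuotRel, Set.ofPred_forall]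
  refine isClosed_iInter fun n => isClosed_eq ?_ ?_
  · exact (continuous_coeff (n + 1)).comp (continuous_snd.comp continuous_fst)
  · have c1 : ∀ m, Continuous fun q : (ClosedDisk × HardySpace) × K => (q.2 : ℕ → ℂ) m := fun m =>
      (continuous_apply m).comp (continuous_subtype_val.comp continuous_snd)
    exact (c1 n).sub ((continuous_subtype_val.comp (continuous_fst.comp continuous_fst)).mul
      (c1 (n + 1)))

theorem measurable_localDirichlet (f : HardySpace) :
    Measurable fun ζ : ClosedDisk => localDirichlet (ζ : ℂ) f :=
  (lowerSemicontinuous_localDirichlet.comp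
    (continuous_id.prodMk continuous_const : Continuous fun ζ : ClosedDisk => (ζ, f))).measurable

theorem norm_le_one (ζ : ClosedDisk) : ‖(ζ : ℂ)‖ ≤ 1 := mem_closedBall_zero_iff.1 ζ.2

/-! ### Properties of the energy -/

theorem dirichletEnergy_smul_le (μ : Measure ClosedDisk) (c : ℂ) (f : HardySpace) :
    dirichletEnergy μ (c • f) ≤ ‖c‖ₑ ^ 2 * dirichletEnergy μ f := by
  unfold dirichletEnergy
  rw [← lintegral_const_mul _ (measurable_localDirichlet f)]
  exact lintegral_mono fun ζ => localDirichlet_smul_le (norm_le_one ζ) c f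

theorem dirichletEnergy_add_le (μ : Measure ClosedDisk) (f g : HardySpace) :
    dirichletEnergy μ (f + g) ^ (1 / 2 : ℝ)
      ≤ dirichletEnergy μ f ^ (1 / 2 : ℝ) + dirichletEnergy μ g ^ (1 / 2 : ℝ) := by
  have e : ∀ x : ℝ≥0∞, (x ^ (1 / 2 : ℝ)) ^ (2 : ℝ) = x := fun x => by
    rw [← ENNReal.rpow_mul]; norm_num
  have h := ENNReal.lintegral_Lp_add_le (μ := μ) (p := 2)
    ((measurable_localDirichlet f).pow_const (1 / 2 : ℝ)).aemeasurable
    ((measurable_localDirichlet g).pow_const (1 / 2 : ℝ)).aemeasurable (by norm_num)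
  simp only [e] at h
  refine le_trans ?_ h
  unfold dirichletEnergy
  refine ENNReal.rpow_le_rpow (lintegral_mono fun ζ => ?_) (by norm_num)
  rw [← e (localDirichlet (ζ : ℂ) (f + g))]
  exact ENNReal.rpow_le_rpow (localDirichlet_add_le (norm_le_one ζ) f g) (by norm_num)

theorem dirichletEnergy_parallelogram_le (μ : Measure ClosedDisk) (f g : HardySpace) :
    dirichletEnergy μ (f + g) + dirichletEnergy μ (f - g)
      ≤ 2 * (dirichletEnergy μ f + dirichletEnergy μ g) := by
  unfold dirichletEnergy
  rw [← lintegral_add_left (measurable_localDirichlet _),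
    ← lintegral_add_left (measurable_localDirichlet _),
    ← lintegral_const_mul 2 (by
      exact (measurable_localDirichlet f).add (measurable_localDirichlet g) :
      Measurable fun ζ : ClosedDisk => localDirichlet (ζ : ℂ) f + localDirichlet (ζ : ℂ) g)]
  exact lintegral_mono fun ζ => localDirichlet_parallelogram_le (norm_le_one ζ) f g

theorem dirichletEnergy_hardyShift_le (μ : Measure ClosedDisk) (f : HardySpace) :
    dirichletEnergy μ (hardyShift f)
      ≤ 2 * ‖f‖ₑ ^ 2 * μ Set.univ + 3 * dirichletEnergy μ f := by
  unfold dirichletEnergy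
  rw [← lintegral_const_mul _ (measurable_localDirichlet f), ← lintegral_const,
    ← lintegral_add_left measurable_const]
  exact lintegral_mono fun ζ => localDirichlet_hardyShift_le (norm_le_one ζ) f

theorem dirichletEnergy_le_of_tendsto (μ : Measure ClosedDisk) {u : ℕ → HardySpace}
    {f : HardySpace} (hu : Tendsto u atTop (𝓝 f)) {c : ℝ≥0∞}
    (hc : ∀ᶠ n in atTop, dirichletEnergy μ (u n) ≤ c) : dirichletEnergy μ f ≤ c := by
  have h1 : dirichletEnergy μ f ≤ ∫⁻ ζ : ClosedDisk,
      liminf (fun n => localDirichlet (ζ : ℂ) (u n)) atTop ∂μ := by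
    refine lintegral_mono fun ζ => ?_
    have hl : LowerSemicontinuous fun g : HardySpace => localDirichlet (ζ : ℂ) g :=
      lowerSemicontinuous_localDirichlet.comp
        (continuous_const.prodMk continuous_id : Continuous fun g : HardySpace => (ζ, g))
    refine le_of_forall_lt fun y hy => ?_
    obtain ⟨y', hy1, hy2⟩ := exists_between hy
    refine hy1.trans_le (le_liminf_of_le (by isBoundedDefault) ?_)
    exact (hu.eventually (hl f y' hy2)).mono fun n hn => hn.le
  refine h1.trans ((lintegral_liminf_le fun n => measurable_localDirichlet (u n)).trans ?_)
  exact liminf_le_of_frequently_le' hc.frequently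

theorem dirichletEnergy_zero (μ : Measure ClosedDisk) : dirichletEnergy μ 0 = 0 := by
  have := dirichletEnergy_smul_le μ 0 0
  simpa using this

theorem dirichletEnergy_neg (μ : Measure ClosedDisk) (f : HardySpace) :
    dirichletEnergy μ (-f) = dirichletEnergy μ f := by
  have h : ∀ g : HardySpace, dirichletEnergy μ (-g) ≤ dirichletEnergy μ g := fun g => by
    have := dirichletEnergy_smul_le μ (-1) g
    simpa using this
  refine le_antisymm (h f) ?_
  have := h (-f)
  rwa [neg_neg] at this

/-! ### The Dirichlet-type space -/

/-- The functions `f ∈ H²` with `∫ D_ζ(f) dμ(ζ) < ∞`. -/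
def dirichletSubmodule (μ : Measure ClosedDisk) : Submodule ℂ HardySpace where
  carrier := {f | dirichletEnergy μ f < ∞}
  zero_mem' := by
    change dirichletEnergy μ 0 < ∞
    rw [dirichletEnergy_zero]; exact ENNReal.zero_lt_top
  add_mem' := by
    intro f g hf hg
    change dirichletEnergy μ (f + g) < ∞
    have h := dirichletEnergy_add_le μ f g
    have h2 := h.trans_lt (ENNReal.add_lt_top.2
      ⟨ENNReal.rpow_lt_top_of_nonneg (by norm_num) (ne_of_lt hf),
        ENNReal.rpow_lt_top_of_nonneg (by norm_num) (ne_of_lt hg)⟩)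
    exact (ENNReal.rpow_lt_top_iff_of_pos (by norm_num)).1 h2
  smul_mem' := by
    intro c f hf
    exact (dirichletEnergy_smul_le μ c f).trans_lt
      (ENNReal.mul_lt_top (by finiteness) hf)

/-- The Dirichlet-type space `D(μ)`, as a vector space the functions `f ∈ H²` with
`∫ D_ζ(f) dμ(ζ) < ∞`. It is a type of its own because its norm is not the one of `H²`. -/
def DirichletSpace (μ : Measure ClosedDisk) : Type := ↥(dirichletSubmodule μ)

namespace DirichletSpace

variable {μ : Measure ClosedDisk}

instance : AddCommGroup (DirichletSpace μ) := inferInstanceAs (AddCommGroup (dirichletSubmodule μ))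

instance : Module ℂ (DirichletSpace μ) := inferInstanceAs (Module ℂ (dirichletSubmodule μ))

/-- The inclusion of `D(μ)` in `H²`. -/
def toHardy : DirichletSpace μ →ₗ[ℂ] HardySpace := (dirichletSubmodule μ).subtype

theorem toHardy_injective : Function.Injective (toHardy (μ := μ)) := Subtype.val_injective

theorem energy_lt_top (f : DirichletSpace μ) : dirichletEnergy μ (toHardy f) < ∞ := f.2

theorem energy_add_sqrt_le (f g : DirichletSpace μ) :
    √(dirichletEnergy μ (toHardy (f + g))).toReal
      ≤ √(dirichletEnergy μ (toHardy f)).toReal + √(dirichletEnergy μ (toHardy g)).toReal := by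
  have h := dirichletEnergy_add_le μ (toHardy f) (toHardy g)
  have t : ∀ f : DirichletSpace μ, dirichletEnergy μ (toHardy f) ^ (1 / 2 : ℝ) ≠ ∞ := fun f =>
    ENNReal.rpow_ne_top_of_nonneg (by norm_num) (energy_lt_top f).ne
  have h2 := ENNReal.toReal_mono (ENNReal.add_ne_top.2 ⟨t f, t g⟩) h
  rw [ENNReal.toReal_add (t f) (t g), ← ENNReal.toReal_rpow, ← ENNReal.toReal_rpow,
    ← ENNReal.toReal_rpow, ← Real.sqrt_eq_rpow, ← Real.sqrt_eq_rpow, ← Real.sqrt_eq_rpow] at h2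
  rwa [map_add]

/-- The norm of `D(μ)`: `‖f‖² = ‖f‖²_{H²} + ∫ D_ζ(f) dμ(ζ)`. -/
instance : NormedAddCommGroup (DirichletSpace μ) :=
  AddGroupNorm.toNormedAddCommGroup
    { toFun := fun f => √(‖toHardy f‖ ^ 2 + (dirichletEnergy μ (toHardy f)).toReal)
      map_zero' := by simp [dirichletEnergy_zero]
      neg' := fun f => by simp [dirichletEnergy_neg]
      add_le' := fun f g => by
        have h1 : ‖toHardy (f + g)‖ ≤ ‖toHardy f‖ + ‖toHardy g‖ := by
          rw [map_add]; exact norm_add_le _ _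
        have h2 := energy_add_sqrt_le f g
        have e : ∀ x : DirichletSpace μ,
            (dirichletEnergy μ (toHardy x)).toReal
              = √(dirichletEnergy μ (toHardy x)).toReal ^ 2 := fun x =>
          (Real.sq_sqrt ENNReal.toReal_nonneg).symm
        have p := fun x : DirichletSpace μ => Real.sqrt_nonneg (dirichletEnergy μ (toHardy x)).toReal
        rw [e (f + g), e f, e g]
        set a := √(dirichletEnergy μ (toHardy f)).toReal
        set b := √(dirichletEnergy μ (toHardy g)).toReal
        have hs := p (f + g)
        have key := norm_add_le (⟨‖toHardy f‖, a⟩ : ℂ) ⟨‖toHardy g‖, b⟩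
        simp only [Complex.norm_eq_sqrt_sq_add_sq, Complex.add_re, Complex.add_im] at key
        refine le_trans (Real.sqrt_le_sqrt ?_) key
        gcongr
      eq_zero_of_map_eq_zero' := fun f hf => by
        rw [Real.sqrt_eq_zero (by positivity)] at hf
        have h0 : ‖toHardy f‖ ^ 2 = 0 :=
          le_antisymm (by
            have : 0 ≤ (dirichletEnergy μ (toHardy f)).toReal := ENNReal.toReal_nonneg
            linarith) (sq_nonneg _)
        refine toHardy_injective ?_
        simpa using h0 }

theorem norm_sq_eq (f : DirichletSpace μ) :
    ‖f‖ ^ 2 = ‖toHardy f‖ ^ 2 + (dirichletEnergy μ (toHardy f)).toReal :=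
  Real.sq_sqrt (by positivity)

instance : NormedSpace ℂ (DirichletSpace μ) where
  norm_smul_le c f := by
    refine abs_le_of_sq_le_sq' ?_ (by positivity) |>.2
    rw [mul_pow, norm_sq_eq, norm_sq_eq, map_smul, norm_smul, mul_pow, mul_add]
    gcongr
    have h := ENNReal.toReal_mono (ENNReal.mul_ne_top (by finiteness) (energy_lt_top f).ne)
      (dirichletEnergy_smul_le μ c (toHardy f))
    simpa using h

theorem parallelogram_le (f g : DirichletSpace μ) :
    ‖f + g‖ ^ 2 + ‖f - g‖ ^ 2 ≤ 2 * (‖f‖ ^ 2 + ‖g‖ ^ 2) := by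
  have h1 := parallelogram_law_with_norm ℂ (toHardy f) (toHardy g)
  have h2 := ENNReal.toReal_mono (ENNReal.mul_ne_top (by norm_num)
      (ENNReal.add_ne_top.2 ⟨(energy_lt_top f).ne, (energy_lt_top g).ne⟩))
    (dirichletEnergy_parallelogram_le μ (toHardy f) (toHardy g))
  have ta := energy_lt_top (f + g)
  have ts := energy_lt_top (f - g)
  rw [map_add] at ta
  rw [map_sub] at ts
  rw [ENNReal.toReal_add ta.ne ts.ne, ENNReal.toReal_mul,
    ENNReal.toReal_add (energy_lt_top f).ne (energy_lt_top g).ne, ENNReal.toReal_ofNat] at h2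
  rw [norm_sq_eq, norm_sq_eq, norm_sq_eq, norm_sq_eq, map_add, map_sub]
  nlinarith [h1, h2]

theorem parallelogram (f g : DirichletSpace μ) :
    ‖f + g‖ * ‖f + g‖ + ‖f - g‖ * ‖f - g‖ = 2 * (‖f‖ * ‖f‖ + ‖g‖ * ‖g‖) := by
  have h1 := parallelogram_le f g
  have h2 := parallelogram_le (f + g) (f - g)
  have e1 : f + g + (f - g) = (2 : ℂ) • f := by rw [two_smul]; abel
  have e2 : f + g - (f - g) = (2 : ℂ) • g := by rw [two_smul]; abel
  rw [e1, e2, norm_smul, norm_smul, Complex.norm_ofNat] at h2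
  nlinarith [h1, h2]

/-- The inner product of `D(μ)`, obtained from its norm by polarization. -/
instance : InnerProductSpace ℂ (DirichletSpace μ) := InnerProductSpace.ofNorm ℂ parallelogram

instance : CompleteSpace (DirichletSpace μ) := by
  refine Metric.complete_of_cauchySeq_tendsto fun u hu => ?_
  have hle : ∀ f : DirichletSpace μ, ‖toHardy f‖ ≤ ‖f‖ := fun f => by
    refine abs_le_of_sq_le_sq' ?_ (norm_nonneg f) |>.2
    rw [norm_sq_eq]
    have : 0 ≤ (dirichletEnergy μ (toHardy f)).toReal := ENNReal.toReal_nonneg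
    linarith
  have hcH : CauchySeq fun n => toHardy (u n) := by
    rw [Metric.cauchySeq_iff'] at hu ⊢
    intro ε hε
    obtain ⟨N, hN⟩ := hu ε hε
    refine ⟨N, fun n hn => lt_of_le_of_lt ?_ (hN n hn)⟩
    rw [dist_eq_norm, dist_eq_norm, ← map_sub]
    exact hle _
  obtain ⟨f, hf⟩ := cauchySeq_tendsto_of_complete hcH
  have key : ∀ ε > 0, ∃ N, ∀ n ≥ N,
      dirichletEnergy μ (f - toHardy (u n)) ≤ ENNReal.ofReal (ε ^ 2) := by
    intro ε hε
    obtain ⟨N, hN⟩ := Metric.cauchySeq_iff.1 hu ε hε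
    refine ⟨N, fun n hn => ?_⟩
    refine dirichletEnergy_le_of_tendsto μ (hf.sub_const (toHardy (u n))) ?_
    filter_upwards [eventually_ge_atTop N] with m hm
    have h1 := hN m hm n hn
    rw [dist_eq_norm] at h1
    rw [← map_sub]
    refine (ENNReal.le_ofReal_iff_toReal_le (energy_lt_top _).ne (sq_nonneg ε)).2 ?_
    have h2 := norm_sq_eq (u m - u n)
    nlinarith [sq_nonneg ‖toHardy (u m - u n)‖, norm_nonneg (u m - u n)]
  obtain ⟨N₀, hN₀⟩ := key 1 one_pos
  have hfmem : f ∈ dirichletSubmodule μ := by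
    have h1 : f - toHardy (u N₀) ∈ dirichletSubmodule μ :=
      (hN₀ N₀ le_rfl).trans_lt ENNReal.ofReal_lt_top
    have h2 := (dirichletSubmodule μ).add_mem h1 (u N₀).2
    have h3 : f - toHardy (u N₀) + (u N₀).1 = f := sub_add_cancel _ _
    rwa [h3] at h2
  let F : DirichletSpace μ := ⟨f, hfmem⟩
  have hF : toHardy F = f := rfl
  refine ⟨F, ?_⟩
  rw [Metric.tendsto_atTop]
  intro ε hε
  obtain ⟨N, hN⟩ := key (ε / 2) (by positivity)
  obtain ⟨N', hN'⟩ := Metric.tendsto_atTop.1 hf (ε / 2) (by positivity)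
  refine ⟨max N N', fun n hn => ?_⟩
  have h1 := hN n (le_of_max_le_left hn)
  have h2 := hN' n (le_of_max_le_right hn)
  rw [dist_comm, dist_eq_norm] at h2
  rw [dist_comm, dist_eq_norm]
  have h3 := norm_sq_eq (F - u n)
  rw [map_sub, hF] at h3
  have h4 := ENNReal.toReal_le_of_le_ofReal (by positivity) h1
  refine lt_of_pow_lt_pow_left₀ 2 hε.le ?_
  nlinarith [norm_nonneg (f - toHardy (u n))]

end DirichletSpace

/-! ### The multiplication operator and its defect operator -/

/-- Multiplication by `z` on `H²`, as a linear map. -/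
def hardyShiftLinear : HardySpace →ₗ[ℂ] HardySpace where
  toFun := hardyShift
  map_add' f g := by ext n; cases n <;> simp
  map_smul' c f := by ext n; cases n <;> simp

theorem hardyShift_mem (μ : Measure ClosedDisk) [IsFiniteMeasure μ] (f : HardySpace)
    (hf : f ∈ dirichletSubmodule μ) : hardyShiftLinear f ∈ dirichletSubmodule μ :=
  (dirichletEnergy_hardyShift_le μ f).trans_lt
    (ENNReal.add_lt_top.2 ⟨by finiteness, ENNReal.mul_lt_top (by finiteness) hf⟩)

/-- Multiplication by `z` on `D(μ)`, as a linear map. -/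
def mulZLinear (μ : Measure ClosedDisk) [IsFiniteMeasure μ] :
    DirichletSpace μ →ₗ[ℂ] DirichletSpace μ :=
  hardyShiftLinear.restrict (hardyShift_mem μ)

theorem toHardy_mulZLinear (μ : Measure ClosedDisk) [IsFiniteMeasure μ] (f : DirichletSpace μ) :
    (mulZLinear μ f).toHardy = hardyShift f.toHardy := rfl

theorem norm_mulZLinear_le (μ : Measure ClosedDisk) [IsFiniteMeasure μ] (f : DirichletSpace μ) :
    ‖mulZLinear μ f‖ ≤ √(3 + 2 * μ.real Set.univ) * ‖f‖ := by
  refine abs_le_of_sq_le_sq' ?_ (by positivity) |>.2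
  rw [mul_pow, Real.sq_sqrt (by positivity), DirichletSpace.norm_sq_eq,
    DirichletSpace.norm_sq_eq, toHardy_mulZLinear]
  have hf := f.energy_lt_top
  have h := dirichletEnergy_hardyShift_le μ f.toHardy
  have h1 := ENNReal.toReal_mono (by finiteness) h
  rw [ENNReal.toReal_add (by finiteness) (by finiteness)] at h1
  have e1 : (2 * ‖f.toHardy‖ₑ ^ 2 * μ Set.univ).toReal
      = 2 * ‖f.toHardy‖ ^ 2 * μ.real Set.univ := by simp [Measure.real]
  have e2 : (3 * dirichletEnergy μ f.toHardy).toReal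
      = 3 * (dirichletEnergy μ f.toHardy).toReal := by simp
  rw [e1, e2] at h1
  have e3 : ‖hardyShift f.toHardy‖ = ‖f.toHardy‖ := by
    rw [← toReal_enorm, enorm_hardyShift, toReal_enorm]
  rw [e3]
  have m : 0 ≤ μ.real Set.univ := measureReal_nonneg
  have q : 0 ≤ (dirichletEnergy μ f.toHardy).toReal := ENNReal.toReal_nonneg
  nlinarith [mul_nonneg m q, sq_nonneg ‖f.toHardy‖]

/-- The multiplication operator `M_z` on `D(μ)`, a bounded operator. -/
def mulZ (μ : Measure ClosedDisk) [IsFiniteMeasure μ] :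
    DirichletSpace μ →L[ℂ] DirichletSpace μ :=
  (mulZLinear μ).mkContinuous √(3 + 2 * μ.real Set.univ) (norm_mulZLinear_le μ)

/-- `M_z f` is the function `z ↦ z f(z)` on the unit disk. -/
theorem hardyEval_mulZ (μ : Measure ClosedDisk) [IsFiniteMeasure μ] (f : DirichletSpace μ)
    {z : ℂ} (hz : ‖z‖ < 1) :
    hardyEval (mulZ μ f).toHardy z = z * hardyEval f.toHardy z :=
  hardyEval_hardyShift f.toHardy hz

/-- The defect operator `M_z^* M_z - I` of `M_z` on `D(μ)`. -/
def defectOperator (μ : Measure ClosedDisk) [IsFiniteMeasure μ] :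
    DirichletSpace μ →L[ℂ] DirichletSpace μ :=
  (ContinuousLinearMap.adjoint (mulZ μ)).comp (mulZ μ) - ContinuousLinearMap.id ℂ _

end DirichletType

end

/-! Everything rests on one identity: for `|ζ| ≤ 1` and `D_ζ(f) < ∞`, `D_ζ(zf) = |f(ζ)|² + D_ζ(f)`
(`HasValue.localDirichlet_hardyShift`). Indeed, if `f - f(ζ) = (z - ζ)h`, then `zf - ζf(ζ) = (z -
ζ)(zh + f(ζ))`, and in `H²` the function `zh` has norm `‖h‖` and is orthogonal to constants. Since
multiplication by `z` is isometric on `H²`, integrating gives `⟨Δf, f⟩ = ‖zf‖² - ‖f‖² = ∫ |f|² dμ`,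
so `Δ` annihilates only functions that vanish `μ`-almost everywhere.

If `Δ` has finite rank, it annihilates some nonzero polynomial, the polynomials being
infinite-dimensional. This polynomial vanishes `μ`-almost everywhere, so `μ` lives on its finitely
many zeros (`exists_eval_ae_eq_zero_of_rank_lt_aleph0`, `exists_eq_sum_dirac_of_ae_mem_finset`). For
general `μ` the identity is integrated only for polynomials, whose values are continuous in `ζ`, so
the measurability of `ζ ↦ f(ζ)` for other `f` never arises.

If `μ` is a sum of `k` point masses, the kernel of `Δ` is exactly the kernel of evaluation at the
`k` points, and evaluation is onto `ℂ^k` by Lagrange interpolation; hence the rank is `k`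
(`rank_defectOperator_of_sum_dirac`). The same count fixes the number of atoms in the other
direction. -/

noncomputable section

namespace DirichletType

open Filter Topology MeasureTheory
open scoped NNReal ENNReal

/-! ### Point values and the effect of multiplication by `z` -/

/-- `w` is the value at `ζ` of `f ∈ H²`, read off from a difference quotient of `f` at `ζ`
lying in `H²`. -/
def HasValue (ζ : ℂ) (f : HardySpace) (w : ℂ) : Prop :=
  ∃ h : HardySpace, QuotRel ζ f h ∧ f 0 + ζ * h 0 = w

namespace HasValue

variable {ζ w w' : ℂ} {f g : HardySpace}

theorem unique (hζ : ‖ζ‖ ≤ 1) (hf : HasValue ζ f w) (hf' : HasValue ζ f w') : w = w' := by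
  obtain ⟨h, r, rfl⟩ := hf
  obtain ⟨h', r', rfl⟩ := hf'
  rw [r.unique hζ r']

theorem add (hf : HasValue ζ f w) (hg : HasValue ζ g w') : HasValue ζ (f + g) (w + w') := by
  obtain ⟨h, r, rfl⟩ := hf
  obtain ⟨h', r', rfl⟩ := hg
  refine ⟨h + h', r.add r', ?_⟩
  simp only [lp.coeFn_add, Pi.add_apply]
  ring

theorem smul (c : ℂ) (hf : HasValue ζ f w) : HasValue ζ (c • f) (c * w) := by
  obtain ⟨h, r, rfl⟩ := hf
  refine ⟨c • h, r.smul c, ?_⟩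
  simp only [lp.coeFn_smul, Pi.smul_apply, smul_eq_mul]
  ring

/-- From `f - w = (z - ζ)h` one gets `zf - ζw = z(z - ζ)h + (z - ζ)w = (z - ζ)(zh + w)`. -/
theorem quotRel_hardyShift {h : HardySpace} (r : QuotRel ζ f h) :
    QuotRel ζ (hardyShift f) (hardyShift h + lp.single 2 0 (f 0 + ζ * h 0) : HardySpace) := by
  intro n
  cases n with
  | zero => simp
  | succ n => simpa using r n

theorem hardyShift (hf : HasValue ζ f w) : HasValue ζ (hardyShift f) (ζ * w) := by
  obtain ⟨h, r, rfl⟩ := hf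
  exact ⟨_, quotRel_hardyShift r, by simp⟩

/-- The quotient for `zf` is `zh + w`. Its constant coefficient is `w` and its remaining
coefficients are those of `h`, so the squared norms add. -/
theorem localDirichlet_hardyShift (hζ : ‖ζ‖ ≤ 1) (hf : HasValue ζ f w) :
    localDirichlet ζ (DirichletType.hardyShift f) = ‖w‖ₑ ^ 2 + localDirichlet ζ f := by
  obtain ⟨h, r, rfl⟩ := hf
  rw [localDirichlet_eq hζ r, localDirichlet_eq hζ (quotRel_hardyShift r), enorm_sq_eq,
    tsum_eq_zero_add' ENNReal.summable, enorm_sq_eq h]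
  simp

theorem one (ζ : ℂ) : HasValue ζ (lp.single 2 0 1 : HardySpace) 1 :=
  ⟨0, fun n => by simp, by simp⟩

end HasValue

theorem exists_hasValue {ζ : ℂ} {f : HardySpace} (H : localDirichlet ζ f ≠ ∞) :
    ∃ w, HasValue ζ f w := by
  obtain ⟨h, r⟩ := exists_quotRel H
  exact ⟨_, h, r, rfl⟩

/-! ### Evaluation functionals on `D(μ)` -/

section Evaluation

variable {μ : Measure ClosedDisk}

/-- Evaluation at a point where every function of `D(μ)` has finite local Dirichlet integral. -/
def valueMap {ζ : ℂ} (hζ : ‖ζ‖ ≤ 1)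
    (H : ∀ f : DirichletSpace μ, localDirichlet ζ f.toHardy ≠ ∞) : DirichletSpace μ →ₗ[ℂ] ℂ where
  toFun f := (exists_hasValue (H f)).choose
  map_add' f g := by
    refine HasValue.unique hζ (exists_hasValue (H (f + g))).choose_spec ?_
    rw [map_add]
    exact (exists_hasValue (H f)).choose_spec.add (exists_hasValue (H g)).choose_spec
  map_smul' c f := by
    refine HasValue.unique hζ (exists_hasValue (H (c • f))).choose_spec ?_
    rw [map_smul]
    exact (exists_hasValue (H f)).choose_spec.smul c

theorem hasValue_valueMap {ζ : ℂ} (hζ : ‖ζ‖ ≤ 1)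
    (H : ∀ f : DirichletSpace μ, localDirichlet ζ f.toHardy ≠ ∞) (f : DirichletSpace μ) :
    HasValue ζ f.toHardy (valueMap hζ H f) :=
  (exists_hasValue (H f)).choose_spec

end Evaluation

/-! ### Polynomials in `D(μ)` -/

section Space

variable (μ : Measure ClosedDisk)

/-- The constant function `1` in `D(μ)`. -/
def oneDirichlet : DirichletSpace μ :=
  ⟨lp.single 2 0 1, by
    change dirichletEnergy μ _ < ∞
    have h : ∀ ζ : ClosedDisk, localDirichlet (ζ : ℂ) (lp.single 2 0 1 : HardySpace) = 0 := by
      intro ζ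
      have r : QuotRel (ζ : ℂ) (lp.single 2 0 1 : HardySpace) (0 : HardySpace) := fun n => by simp
      rw [localDirichlet_eq (norm_le_one ζ) r]
      simp
    simp [dirichletEnergy, h]⟩

variable [IsFiniteMeasure μ]

/-- Polynomials as elements of `D(μ)`. -/
def polyDirichlet : Polynomial ℂ →ₗ[ℂ] DirichletSpace μ :=
  (LinearMap.applyₗ (oneDirichlet μ)).comp (Polynomial.aeval (mulZLinear μ)).toLinearMap

/-- Holds for every complex `ζ`: the constant `1` has quotient `0`, and each multiplication by `z`
keeps a quotient in `H²` and multiplies the value by `ζ`. -/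
theorem hasValue_polyDirichlet (p : Polynomial ℂ) (ζ : ℂ) :
    HasValue ζ (polyDirichlet μ p).toHardy (p.eval ζ) := by
  induction p using Polynomial.induction_on' with
  | add p q hp hq =>
    rw [map_add, map_add, Polynomial.eval_add]
    exact hp.add hq
  | monomial n a =>
    have h1 : ∀ n : ℕ, HasValue ζ (((mulZLinear μ) ^ n) (oneDirichlet μ)).toHardy (ζ ^ n) := by
      intro n
      induction n with
      | zero => exact HasValue.one ζ
      | succ n ih =>
        rw [pow_succ', pow_succ', Module.End.mul_apply, toHardy_mulZLinear]
        exact ih.hardyShift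
    have h2 : polyDirichlet μ (Polynomial.monomial n a)
        = a • ((mulZLinear μ) ^ n) (oneDirichlet μ) := by
      simp [polyDirichlet, Polynomial.aeval_monomial, Algebra.algebraMap_eq_smul_one]
    rw [h2, map_smul, Polynomial.eval_monomial]
    exact (h1 n).smul a

/-! ### The quadratic form and the kernel of the defect operator -/

theorem inner_defectOperator (f g : DirichletSpace μ) :
    inner ℂ (defectOperator μ f) g = inner ℂ (mulZ μ f) (mulZ μ g) - inner ℂ f g := by
  simp [defectOperator, ContinuousLinearMap.adjoint_inner_left]

/-- Multiplication by `z` is isometric on `H²`, so only the energy term can change. -/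
theorem norm_mulZ_sq (f : DirichletSpace μ) :
    ‖mulZ μ f‖ ^ 2 = ‖f.toHardy‖ ^ 2 + (dirichletEnergy μ (hardyShift f.toHardy)).toReal := by
  have e : ‖hardyShift f.toHardy‖ = ‖f.toHardy‖ := by
    rw [← toReal_enorm, enorm_hardyShift, toReal_enorm]
  rw [DirichletSpace.norm_sq_eq, ← e]
  rfl

theorem dirichletEnergy_hardyShift_of_defectOperator_eq_zero {f : DirichletSpace μ}
    (hf : defectOperator μ f = 0) :
    dirichletEnergy μ (hardyShift f.toHardy) = dirichletEnergy μ f.toHardy := by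
  have h := inner_defectOperator μ f f
  rw [hf, inner_zero_left, inner_self_eq_norm_sq_to_K, inner_self_eq_norm_sq_to_K] at h
  have h2 : ‖mulZ μ f‖ ^ 2 = ‖f‖ ^ 2 := by
    have := sub_eq_zero.1 h.symm
    exact_mod_cast this
  rw [norm_mulZ_sq, DirichletSpace.norm_sq_eq] at h2
  -- Both energies are finite, so equality of their real parts is equality in `[0, ∞]`.
  refine (ENNReal.toReal_eq_toReal_iff' ?_ f.energy_lt_top.ne).1 (add_left_cancel h2)
  exact (mulZ μ f).energy_lt_top.ne

/-- The inner product of `D(μ)` comes from the norm by polarization, so membership in the kernel is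
tested on norms alone. If the form `g ↦ ‖zg‖² - ‖g‖²` vanishes at `f` and is invariant under
translation by `f`, its cross term `2 Re ⟨Δf, g⟩` is zero. -/
theorem defectOperator_eq_zero_of_norm {f : DirichletSpace μ}
    (h0 : ‖mulZ μ f‖ ^ 2 = ‖f‖ ^ 2)
    (h : ∀ g, ‖mulZ μ (f + g)‖ ^ 2 - ‖f + g‖ ^ 2 = ‖mulZ μ g‖ ^ 2 - ‖g‖ ^ 2) :
    defectOperator μ f = 0 := by
  have key : ∀ g, RCLike.re (inner ℂ (defectOperator μ f) g) = 0 := by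
    intro g
    have h1 := h g
    rw [map_add, norm_add_sq (𝕜 := ℂ), norm_add_sq (𝕜 := ℂ)] at h1
    rw [inner_defectOperator, map_sub]
    linarith
  -- Choosing `g = Δf` turns the vanishing real part into `‖Δf‖² = 0`.
  have h2 := key (defectOperator μ f)
  rwa [inner_self_eq_norm_sq, sq_eq_zero_iff, norm_eq_zero] at h2

/-- A nonzero polynomial in the kernel of the defect operator vanishes `μ`-almost everywhere. -/
theorem ae_eval_eq_zero {p : Polynomial ℂ} (hp : defectOperator μ (polyDirichlet μ p) = 0) :
    ∀ᵐ ζ : ClosedDisk ∂μ, p.eval (ζ : ℂ) = 0 := by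
  have h := dirichletEnergy_hardyShift_of_defectOperator_eq_zero μ hp
  have hm : Measurable fun ζ : ClosedDisk => ‖p.eval (ζ : ℂ)‖ₑ ^ 2 :=
    (((p.continuous.comp continuous_subtype_val).enorm).measurable).pow_const 2
  have h1 : dirichletEnergy μ (hardyShift (polyDirichlet μ p).toHardy)
      = ∫⁻ ζ : ClosedDisk, ‖p.eval (ζ : ℂ)‖ₑ ^ 2 ∂μ
        + dirichletEnergy μ (polyDirichlet μ p).toHardy := by
    unfold dirichletEnergy
    rw [← lintegral_add_left hm]
    exact lintegral_congr fun ζ =>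
      (hasValue_polyDirichlet μ p ζ).localDirichlet_hardyShift (norm_le_one ζ)
  rw [h1] at h
  -- The energy of `p` is finite and may be cancelled.
  have h2 : ∫⁻ ζ : ClosedDisk, ‖p.eval (ζ : ℂ)‖ₑ ^ 2 ∂μ = 0 := by
    exact (ENNReal.add_left_inj (polyDirichlet μ p).energy_lt_top.ne).1
      (h.trans (zero_add _).symm)
  filter_upwards [(lintegral_eq_zero_iff hm).1 h2] with ζ hζ
  simpa using hζ

/-! ### The two directions: point masses and finite rank -/

variable {μ}

/-- Here `⟨Δf, f⟩ = ∑ cᵢ |f(ζᵢ)|²`. Positivity of the weights makes the kernel that of the joint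
evaluation map, and distinctness of the points makes that map onto. -/
theorem rank_defectOperator_of_sum_dirac {k : ℕ} {c : Fin k → ℝ≥0} {ζ : Fin k → ClosedDisk}
    (hc : ∀ i, 0 < c i) (hinj : Function.Injective ζ)
    (hμ : μ = ∑ i, c i • Measure.dirac (ζ i)) :
    LinearMap.rank (defectOperator μ : DirichletSpace μ →ₗ[ℂ] DirichletSpace μ)
      = (k : Cardinal) := by
  have energy : ∀ f : HardySpace,
      dirichletEnergy μ f = ∑ i, (c i : ℝ≥0∞) * localDirichlet (ζ i : ℂ) f := by
    intro f
    rw [dirichletEnergy, hμ, lintegral_finsetSum_measure]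
    refine Finset.sum_congr rfl fun i _ => ?_
    rw [lintegral_smul_measure, lintegral_dirac' _ (measurable_localDirichlet f)]
    rfl
  -- A positive weight at `ζᵢ` forces `D_ζᵢ(f) < ∞` on all of `D(μ)`, so evaluation there is defined
  -- everywhere, also on the unit circle.
  have H : ∀ i, ∀ f : DirichletSpace μ, localDirichlet (ζ i : ℂ) f.toHardy ≠ ∞ := by
    intro i f hf
    have h1 := f.energy_lt_top
    rw [energy, ENNReal.sum_lt_top] at h1
    have h2 := h1 i (Finset.mem_univ i)
    rw [hf, ENNReal.mul_top (by simpa using (hc i).ne')] at h2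
    exact lt_irrefl _ h2
  let ev : DirichletSpace μ →ₗ[ℂ] (Fin k → ℂ) :=
    LinearMap.pi fun i => valueMap (norm_le_one (ζ i)) (H i)
  have hev : ∀ f i, HasValue (ζ i : ℂ) f.toHardy (ev f i) := fun f i =>
    hasValue_valueMap (norm_le_one (ζ i)) (H i) f
  have shift : ∀ f : DirichletSpace μ, dirichletEnergy μ (hardyShift f.toHardy)
      = ∑ i, (c i : ℝ≥0∞) * ‖ev f i‖ₑ ^ 2 + dirichletEnergy μ f.toHardy := by
    intro f
    rw [energy, energy, ← Finset.sum_add_distrib]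
    refine Finset.sum_congr rfl fun i _ => ?_
    rw [(hev f i).localDirichlet_hardyShift (norm_le_one _), mul_add]
  have norm_eq : ∀ f : DirichletSpace μ,
      ‖mulZ μ f‖ ^ 2 - ‖f‖ ^ 2 = (∑ i, (c i : ℝ≥0∞) * ‖ev f i‖ₑ ^ 2).toReal := by
    intro f
    rw [norm_mulZ_sq, DirichletSpace.norm_sq_eq, shift,
      ENNReal.toReal_add (ENNReal.sum_ne_top.2 fun i _ => by finiteness) f.energy_lt_top.ne]
    ring
  have hker : LinearMap.ker (defectOperator μ : DirichletSpace μ →ₗ[ℂ] DirichletSpace μ)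
      = LinearMap.ker ev := by
    ext f
    rw [LinearMap.mem_ker, LinearMap.mem_ker, ContinuousLinearMap.coe_coe]
    constructor
    · intro hf
      have h1 := dirichletEnergy_hardyShift_of_defectOperator_eq_zero μ hf
      rw [shift] at h1
      have h2 := (ENNReal.add_left_inj f.energy_lt_top.ne).1 (h1.trans (zero_add _).symm)
      ext i
      -- A vanishing sum of nonnegative terms vanishes termwise, and `cᵢ ≠ 0`.
      have h3 := Finset.sum_eq_zero_iff.1 h2 i (Finset.mem_univ i)
      simpa [(hc i).ne'] using h3
    · intro hf
      refine defectOperator_eq_zero_of_norm μ ?_ fun g => ?_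
      · have := norm_eq f
        rw [hf] at this
        simpa [sub_eq_zero] using this
      · rw [norm_eq, norm_eq, map_add, hf, zero_add]
  have hsurj : Function.Surjective ev := by
    intro y
    have hζ : Set.InjOn (fun i => (ζ i : ℂ)) (Finset.univ : Finset (Fin k)) :=
      (Subtype.val_injective.comp hinj).injOn
    refine ⟨polyDirichlet μ (Lagrange.interpolate Finset.univ (fun i => (ζ i : ℂ)) y), ?_⟩
    ext i
    refine (hev _ i).unique (norm_le_one _) ?_
    have h := hasValue_polyDirichlet μ
      (Lagrange.interpolate Finset.univ (fun i => (ζ i : ℂ)) y) (ζ i)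
    rwa [Lagrange.eval_interpolate_at_node y hζ (Finset.mem_univ i)] at h
  let T : DirichletSpace μ →ₗ[ℂ] DirichletSpace μ := defectOperator μ
  -- The range of `Δ` is `D(μ)` modulo `ker Δ = ker ev`, which the surjection `ev` identifies with
  -- `ℂ^k`.
  let e : LinearMap.range T ≃ₗ[ℂ] (Fin k → ℂ) :=
    T.quotKerEquivRange.symm.trans
      ((Submodule.quotEquivOfEq _ _ hker).trans (ev.quotKerEquivOfSurjective hsurj))
  have := e.lift_rank_eq
  simpa [LinearMap.rank] using this

/-- The infinite-dimensional space of polynomials cannot embed in the finite-dimensional range of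
`Δ`, so `Δ` kills a nonzero polynomial. -/
theorem exists_eval_ae_eq_zero_of_rank_lt_aleph0
    (h : LinearMap.rank (defectOperator μ : DirichletSpace μ →ₗ[ℂ] DirichletSpace μ)
      < Cardinal.aleph0) :
    ∃ p : Polynomial ℂ, p ≠ 0 ∧ ∀ᵐ ζ : ClosedDisk ∂μ, p.eval (ζ : ℂ) = 0 := by
  let T : DirichletSpace μ →ₗ[ℂ] DirichletSpace μ := defectOperator μ
  have hnot : ¬ Function.Injective (T ∘ₗ polyDirichlet μ) := by
    intro hinj
    have : Module.Finite ℂ (LinearMap.range T) := Module.rank_lt_aleph0_iff.1 h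
    have hinj' : Function.Injective (T.rangeRestrict ∘ₗ polyDirichlet μ) := fun p q hpq =>
      hinj (congrArg Subtype.val hpq)
    exact Polynomial.not_finite (Module.Finite.of_injective _ hinj')
  rw [← LinearMap.ker_eq_bot, Submodule.eq_bot_iff] at hnot
  push Not at hnot
  obtain ⟨p, hp, hp0⟩ := hnot
  exact ⟨p, hp0, ae_eval_eq_zero μ hp⟩

end Space

theorem exists_eq_sum_dirac_of_ae_mem_finset {α : Type*} [MeasurableSpace α]
    [MeasurableSingletonClass α] (μ : Measure α) [IsFiniteMeasure μ] (s : Finset α)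
    (hs : ∀ᵐ x ∂μ, x ∈ s) :
    ∃ (m : ℕ) (c : Fin m → ℝ≥0) (x : Fin m → α),
      (∀ i, 0 < c i) ∧ Function.Injective x ∧ μ = ∑ i, c i • Measure.dirac (x i) := by
  classical
  -- Points of mass zero are discarded because the weights must be strictly positive.
  let t := s.filter fun x => μ {x} ≠ 0
  have ht : ∀ x ∈ s, x ∉ t → μ {x} = 0 := fun x hx hxt => by
    by_contra h0
    exact hxt (Finset.mem_filter.2 ⟨hx, h0⟩)
  let e := t.equivFin
  refine ⟨t.card, fun i => (μ {(e.symm i : α)}).toNNReal, fun i => (e.symm i : α), ?_, ?_, ?_⟩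
  · intro i
    exact ENNReal.toNNReal_pos (Finset.mem_filter.1 (e.symm i).2).2 (measure_ne_top _ _)
  · exact Subtype.val_injective.comp e.symm.injective
  · ext u hu
    have h1 : μ u = μ.restrict s u := by
      rw [Measure.restrict_eq_self_of_ae_mem hs]
    have h2 : μ.restrict s u = ∑ x ∈ s, μ {x} * u.indicator 1 x := by
      have : (∫⁻ x in (s : Set α), u.indicator 1 x ∂μ) = μ.restrict s u :=
        lintegral_indicator_one hu
      rw [← this, lintegral_finset]
      exact Finset.sum_congr rfl fun x _ => mul_comm _ _
    have h3 : ∑ x ∈ s, μ {x} * u.indicator 1 x = ∑ x ∈ t, μ {x} * u.indicator 1 x := by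
      refine (Finset.sum_subset (Finset.filter_subset _ _) fun x hx hxt => ?_).symm
      rw [ht x hx hxt, zero_mul]
    rw [h1, h2, h3, ← Finset.sum_coe_sort, ← e.symm.sum_comp, Measure.finsetSum_apply]
    refine Finset.sum_congr rfl fun i _ => ?_
    rw [Measure.smul_apply, Measure.dirac_apply' _ hu, ENNReal.smul_def, smul_eq_mul,
      ENNReal.coe_toNNReal (measure_ne_top _ _)]

end DirichletType

end

theorem proposition2p1 (μ : MeasureTheory.Measure DirichletType.ClosedDisk)
    [MeasureTheory.IsFiniteMeasure μ] (k : ℕ) :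
    LinearMap.rank (DirichletType.defectOperator μ :
        DirichletType.DirichletSpace μ →ₗ[ℂ] DirichletType.DirichletSpace μ) = (k : Cardinal) ↔
      ∃ (c : Fin k → NNReal) (ζ : Fin k → DirichletType.ClosedDisk),
        (∀ i, 0 < c i) ∧ Function.Injective ζ ∧
          μ = ∑ i, c i • MeasureTheory.Measure.dirac (ζ i) := by
  constructor
  · intro h
    obtain ⟨p, hp0, hp⟩ := DirichletType.exists_eval_ae_eq_zero_of_rank_lt_aleph0
      (h.trans_lt (Cardinal.natCast_lt_aleph0))
    have hfin : {ζ : DirichletType.ClosedDisk | p.eval (ζ : ℂ) = 0}.Finite :=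
      (Polynomial.finite_setOfPred_isRoot hp0).preimage Subtype.val_injective.injOn
    obtain ⟨m, c, ζ, hc, hinj, hμ⟩ :=
      DirichletType.exists_eq_sum_dirac_of_ae_mem_finset μ hfin.toFinset
        (hp.mono fun ζ hζ => by simpa using hζ)
    -- The number `m` of atoms is so far unrelated to `k`; computing the rank again from the atoms
    -- gives `m = k`.
    have hm := DirichletType.rank_defectOperator_of_sum_dirac hc hinj hμ
    obtain rfl : m = k := by exact_mod_cast hm.symm.trans h
    exact ⟨c, ζ, hc, hinj, hμ⟩
  · rintro ⟨c, ζ, hc, hinj, hμ⟩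
    exact DirichletType.rank_defectOperator_of_sum_dirac hc hinj hμ
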